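/- Let $p$ be the transition matrix of a birth and death chain on $\mathbb Z_+=\{0,1,2,\dots\}$ with $p(x,y)=0$ if and only if $|x-y|\neq 1$, $p(0,1)=1$, and, for $x\ge 1$, $p(x,x+1)=\tfrac12-c_x$ and $p(x,x-1)=\tfrac12+c_x$, where for some $\alpha\in(0,1)$ $$0<\liminf_{x\to\infty}c_x x^{\alpha}\le\limsup_{x\to\infty}c_x x^{\alpha}<\infty .$$ Let $\pi(x)=\tilde\pi(x)/\sum_{y\ge0}\tilde\pi(y)$ with $\tilde\pi(x)=\prod_{k=1}^{x}\frac{p(k-1,k)}{p(k,k-1)}$ be its invariant law, let $\{X_n\}_{n\ge0}$ be the stationary Markov chain with transition matrix $p$ and $X_0\sim\pi$, and let $V:\mathbb Z_+\to\mathbb R$ satisfy $\sum_x V(x)^2\pi(x)<\infty$ and $\sum_x V(x)\pi(x)=0$. Then the limit $$D^2(V)=\lim_{N\to\infty}\frac1N\,\mathbb E\Big[\Big(\sum_{n=0}^{N}V(X_n)\Big)^2\Big]$$ exists in $[0,\infty]$, and it is finite if and only if $$\sum_{x\ge0}\frac1{\pi(x)}\Big(\sum_{0\le y\le x}V(y)\pi(y)\Big)^2<\infty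 .$$ -/

import Mathlib

open Filter Topology MeasureTheory ProbabilityTheory
open scoped ENNReal

/-- `p` is the transition matrix of a birth and death chain on `{0, 1, 2, …}` which moves by exactly
one step at each time: a stochastic matrix whose nonzero entries are exactly those between
neighbours, the state `0` being reflecting. -/
structure IsBirthDeathMatrix (p : ℕ → ℕ → ℝ) : Prop where
  nonneg : ∀ x y, 0 ≤ p x y
  row_sum : ∀ x, HasSum (p x) 1
  zero_iff : ∀ x y, p x y = 0 ↔ ¬ (y = x + 1 ∨ x = y + 1)
  reflecting : p 0 1 = 1

/-- For `x ≥ 1` the chain steps right with probability `1/2 - c x` and left with probability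
`1/2 + c x`, where `0 < liminf c x * x ^ α ≤ limsup c x * x ^ α < ∞`
(lower and upper limits taken in the extended reals). -/
structure HasWeakLeftDrift (p : ℕ → ℕ → ℝ) (c : ℕ → ℝ) (α : ℝ) : Prop where
  right : ∀ x, 1 ≤ x → p x (x + 1) = 1 / 2 - c x
  left : ∀ x, 1 ≤ x → p x (x - 1) = 1 / 2 + c x
  liminf_pos : (0 : EReal) < liminf (fun x : ℕ => ((c x * (x : ℝ) ^ α : ℝ) : EReal)) atTop
  limsup_lt_top : limsup (fun x : ℕ => ((c x * (x : ℝ) ^ α : ℝ) : EReal)) atTop < ⊤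

/-- The reversible measure `∏_{k=1}^x p(k-1,k) / p(k,k-1)`, normalized to be `1` at `0`. -/
noncomputable def reversibleMeasure (p : ℕ → ℕ → ℝ) (x : ℕ) : ℝ :=
  ∏ k ∈ Finset.Icc 1 x, p (k - 1) k / p k (k - 1)

/-- The invariant law: the reversible measure divided by its total mass
(which is finite for a positive recurrent chain). -/
noncomputable def invariantLaw (p : ℕ → ℕ → ℝ) (x : ℕ) : ℝ :=
  reversibleMeasure p x / ∑' y, reversibleMeasure p y

/-- `X` is a Markov chain on `{0, 1, 2, …}`, defined on the probability space `(Ω, μ)`, with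
transition matrix `p`: conditionally on any history of positive probability,
the next state is chosen according to `p`. -/
structure IsMarkovChain {Ω : Type*} [MeasurableSpace Ω] (μ : Measure Ω)
    (p : ℕ → ℕ → ℝ) (X : ℕ → Ω → ℕ) : Prop where
  measurable : ∀ n, Measurable (X n)
  step : ∀ (n : ℕ) (x : ℕ → ℕ), μ {ω | ∀ i ≤ n, X i ω = x i} ≠ 0 →
    (ProbabilityTheory.cond μ {ω | ∀ i ≤ n, X i ω = x i}) {ω | X (n + 1) ω = x (n + 1)} =
      ENNReal.ofReal (p (x n) (x (n + 1)))

/-- `N⁻¹ 𝔼[(∑_{n=0}^N V(X_n))²]`, as an extended nonnegative real. -/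
noncomputable def scaledSecondMoment {Ω : Type*} [MeasurableSpace Ω] (μ : Measure Ω)
    (X : ℕ → Ω → ℕ) (V : ℕ → ℝ) (N : ℕ) : ℝ≥0∞ :=
  (∫⁻ ω, ENNReal.ofReal ((∑ n ∈ Finset.range (N + 1), V (X n ω)) ^ 2) ∂μ) / (N : ℝ≥0∞)

/-! On `L²(π)` the one-step operator `P` is a contraction, symmetric by detailed balance, and
stationarity with the Markov property gives `𝔼[V(X_i) V(X_{i+k})] = ⟪V, P ^ k V⟫ = a k`. The second
moment of the sum is thus a sum of the terms `2 * ∑_{k ≤ i} a k - a 0`, and the question is how the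
partial sums of `a` behave.

The chain has period 2, so `a k` need not tend to `0`. Pairing cures this without the spectral
theorem: `a (2k) + a (2k+1) = ⟪P ^ k V, (1 + P) P ^ k V⟫ ≥ 0`. Hence the partial sums of `a` are
monotone up to a bounded error, the limit `D` exists in `[0, ∞]`, and it is finite exactly when the
paired series converges (`exists_tendsto_norm_sum_sq_div`).

By `summable_pairedAutocov_iff` this convergence says that `V` is a bounded functional for the
Dirichlet form `⟪f, (1 - P) f⟫`. In one dimension that form is diagonal on the indicators of `[0,
n]`, with entries `π(n) p(n, n+1)` (`inner_initialIndicator_sub`), and these indicators span a dense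
subspace. Boundedness therefore becomes summability of `(∑_{y ≤ n} V(y) π(y))² / (π(n) p(n, n+1))`
(`exists_inner_sq_le_iff`). The drift condition keeps `p(n, n+1)` away from `0`, so that factor can
be dropped. -/

section SymmetricContraction

variable {H : Type*} [NormedAddCommGroup H] [InnerProductSpace ℝ H]

/-- The autocovariances `⟪v, P ^ k v⟫` of a vector under an operator. -/
noncomputable def autocov (P : H →L[ℝ] H) (v : H) (k : ℕ) : ℝ := inner ℝ v ((P ^ k) v)

/-- The sum of two consecutive autocovariances, the first one of even order. -/
noncomputable def pairedAutocov (P : H →L[ℝ] H) (v : H) (k : ℕ) : ℝ :=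
  autocov P v (2 * k) + autocov P v (2 * k + 1)

/-! ### Symmetric contractions and the `H₋₁` criterion. -/

variable {P : H →L[ℝ] H}

theorem inner_pow_pow (hs : ∀ x y, inner ℝ (P x) y = inner ℝ x (P y)) (v : H) (i j : ℕ) :
    inner ℝ ((P ^ i) v) ((P ^ j) v) = autocov P v (i + j) := by
  induction i generalizing j with
  | zero => simp [autocov]
  | succ i ih =>
    rw [pow_succ', mul_apply_eq_comp, hs, ← mul_apply_eq_comp, ← pow_succ',
      ih]
    congr 1
    omega

theorem abs_inner_apply_le (hP : ∀ x, ‖P x‖ ≤ ‖x‖) (x : H) : |inner ℝ x (P x)| ≤ ‖x‖ ^ 2 := by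
  calc |inner ℝ x (P x)| ≤ ‖x‖ * ‖P x‖ := abs_real_inner_le_norm _ _
    _ ≤ ‖x‖ * ‖x‖ := by gcongr; exact hP x
    _ = ‖x‖ ^ 2 := by ring

theorem inner_self_add_apply_nonneg (hP : ∀ x, ‖P x‖ ≤ ‖x‖) (x : H) :
    0 ≤ inner ℝ x (x + P x) := by
  rw [inner_add_right, real_inner_self_eq_norm_sq]
  linarith [neg_le_of_abs_le (abs_inner_apply_le hP x)]

theorem inner_self_sub_apply_nonneg (hP : ∀ x, ‖P x‖ ≤ ‖x‖) (x : H) :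
    0 ≤ inner ℝ x (x - P x) := by
  rw [inner_sub_right, real_inner_self_eq_norm_sq]
  linarith [le_of_abs_le (abs_inner_apply_le hP x)]

/-- Applied to `x = P ^ k v`, this shows that `(1 + P) P ^ k v` tends to `0` in norm as soon as the
paired autocovariances do. -/
theorem norm_add_apply_sq_le (hP : ∀ x, ‖P x‖ ≤ ‖x‖) (x : H) :
    ‖x + P x‖ ^ 2 ≤ 2 * inner ℝ x (x + P x) := by
  rw [norm_add_sq_real, inner_add_right, real_inner_self_eq_norm_sq]
  have := pow_le_pow_left₀ (norm_nonneg _) (hP x) 2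
  linarith

/-- Cauchy–Schwarz for the positive semidefinite Dirichlet form, from the discriminant of `t ↦ ⟪y' ,
(1 - P) y'⟫` with `y' = x + t • y`. -/
theorem inner_sub_apply_sq_le (hs : ∀ x y, inner ℝ (P x) y = inner ℝ x (P y))
    (hP : ∀ x, ‖P x‖ ≤ ‖x‖) (x y : H) :
    inner ℝ (x - P x) y ^ 2 ≤ inner ℝ x (x - P x) * inner ℝ y (y - P y) := by
  have key : ∀ t : ℝ, 0 ≤ inner ℝ y (y - P y) * (t * t) + 2 * inner ℝ (x - P x) y * t +
      inner ℝ x (x - P x) := by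
    intro t
    have h := inner_self_sub_apply_nonneg hP (x + t • y)
    have h1 : inner ℝ y (P x) = inner ℝ x (P y) := by rw [← hs, real_inner_comm]
    have h2 : inner ℝ (P x) y = inner ℝ x (P y) := hs x y
    have h3 : inner ℝ y x = inner ℝ x y := real_inner_comm _ _
    simp only [map_add, map_smul, inner_add_left, inner_add_right, inner_sub_right,
      inner_smul_left, inner_smul_right, RCLike.conj_to_real, inner_sub_left, h1, h2, h3] at h ⊢
    linarith
  have := discrim_le_zero key
  rw [discrim] at this
  linarith

theorem pairedAutocov_eq (hs : ∀ x y, inner ℝ (P x) y = inner ℝ x (P y)) (v : H) (k : ℕ) :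
    pairedAutocov P v k = inner ℝ ((P ^ k) v) ((P ^ k) v + P ((P ^ k) v)) := by
  rw [inner_add_right, ← mul_apply_eq_comp P, ← pow_succ', inner_pow_pow hs,
    inner_pow_pow hs, pairedAutocov]
  congr 2 <;> omega

theorem pairedAutocov_nonneg (hs : ∀ x y, inner ℝ (P x) y = inner ℝ x (P y))
    (hP : ∀ x, ‖P x‖ ≤ ‖x‖) (v : H) (k : ℕ) : 0 ≤ pairedAutocov P v k := by
  rw [pairedAutocov_eq hs]
  exact inner_self_add_apply_nonneg hP _

theorem norm_pow_apply_le (hP : ∀ x, ‖P x‖ ≤ ‖x‖) (v : H) (k : ℕ) : ‖(P ^ k) v‖ ≤ ‖v‖ := by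
  induction k with
  | zero => simp
  | succ k ih =>
    rw [pow_succ', mul_apply_eq_comp]
    exact (hP _).trans ih

theorem autocov_two_mul (hs : ∀ x y, inner ℝ (P x) y = inner ℝ x (P y)) (v : H) (k : ℕ) :
    autocov P v (2 * k) = ‖(P ^ k) v‖ ^ 2 := by
  rw [← real_inner_self_eq_norm_sq, inner_pow_pow hs, two_mul]

theorem antitone_autocov_two_mul (hs : ∀ x y, inner ℝ (P x) y = inner ℝ x (P y))
    (hP : ∀ x, ‖P x‖ ≤ ‖x‖) (v : H) : Antitone fun k => autocov P v (2 * k) := by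
  refine antitone_nat_of_succ_le fun k => ?_
  simp only [autocov_two_mul hs]
  rw [pow_succ' P, mul_apply_eq_comp]
  exact pow_le_pow_left₀ (norm_nonneg _) (hP _) 2

theorem exists_tendsto_autocov_two_mul (hs : ∀ x y, inner ℝ (P x) y = inner ℝ x (P y))
    (hP : ∀ x, ‖P x‖ ≤ ‖x‖) (v : H) :
    ∃ l, Tendsto (fun k => autocov P v (2 * k)) atTop (𝓝 l) := by
  refine ⟨_, tendsto_atTop_ciInf (antitone_autocov_two_mul hs hP v) ⟨0, ?_⟩⟩
  rintro _ ⟨k, rfl⟩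
  simp only [autocov_two_mul hs]
  positivity

theorem sum_range_two_mul_autocov (P : H →L[ℝ] H) (v : H) (m : ℕ) :
    ∑ k ∈ Finset.range (2 * m), autocov P v k = ∑ k ∈ Finset.range m, pairedAutocov P v k := by
  induction m with
  | zero => simp
  | succ m ih =>
    rw [show 2 * (m + 1) = 2 * m + 1 + 1 by ring, Finset.sum_range_succ, Finset.sum_range_succ, ih,
      Finset.sum_range_succ, pairedAutocov]
    ring

theorem sub_apply_sum_pow (P : H →L[ℝ] H) (v : H) (n : ℕ) :
    (∑ j ∈ Finset.range n, (P ^ j) v) - P (∑ j ∈ Finset.range n, (P ^ j) v) = v - (P ^ n) v := by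
  induction n with
  | zero => simp
  | succ n ih =>
    rw [Finset.sum_range_succ, map_add, add_sub_add_comm, ih, pow_succ',
      mul_apply_eq_comp]
    abel

theorem inner_sum_pow (P : H →L[ℝ] H) (v : H) (m : ℕ) :
    inner ℝ v (∑ j ∈ Finset.range (2 * m), (P ^ j) v) =
      ∑ k ∈ Finset.range m, pairedAutocov P v k := by
  rw [inner_sum, ← sum_range_two_mul_autocov]
  rfl

/-- The Dirichlet form of the partial sums of the Neumann series. -/
theorem inner_sum_pow_sub_apply_le (hs : ∀ x y, inner ℝ (P x) y = inner ℝ x (P y))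
    (hP : ∀ x, ‖P x‖ ≤ ‖x‖) (v : H) (m : ℕ) :
    inner ℝ (∑ j ∈ Finset.range (2 * m), (P ^ j) v)
      ((∑ j ∈ Finset.range (2 * m), (P ^ j) v) - P (∑ j ∈ Finset.range (2 * m), (P ^ j) v)) ≤
      ∑ k ∈ Finset.range m, pairedAutocov P v k := by
  rw [sub_apply_sum_pow, inner_sub_right, real_inner_comm, inner_sum_pow]
  -- By symmetry the boundary term is the block of autocovariances from `2m` to `4m - 1`, a sum of
  -- nonnegative pairs, so dropping it gives an upper bound.
  have : inner ℝ (∑ j ∈ Finset.range (2 * m), (P ^ j) v) ((P ^ (2 * m)) v) =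
      ∑ k ∈ Finset.range m, pairedAutocov P v (m + k) := by
    have h := Finset.sum_range_add (fun k => autocov P v k) (2 * m) (2 * m)
    rw [← two_mul, sum_range_two_mul_autocov, sum_range_two_mul_autocov, two_mul,
      Finset.sum_range_add] at h
    rw [sum_inner]
    simp only [inner_pow_pow hs]
    rw [← two_mul] at h
    simp only [add_comm _ (2 * m)]
    linarith
  rw [this]
  have := Finset.sum_nonneg fun k (_ : k ∈ Finset.range m) => pairedAutocov_nonneg hs hP v (m + k)
  linarith

/-- The `H₋₁` criterion: the paired autocovariances are summable exactly when `v` is a bounded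
functional for the Dirichlet form. -/
theorem summable_pairedAutocov_iff (hs : ∀ x y, inner ℝ (P x) y = inner ℝ x (P y))
    (hP : ∀ x, ‖P x‖ ≤ ‖x‖) (v : H) :
    Summable (pairedAutocov P v) ↔ ∃ C, ∀ f, inner ℝ v f ^ 2 ≤ C * inner ℝ f (f - P f) := by
  have hd := pairedAutocov_nonneg hs hP v
  constructor
  · intro h
    set s := ∑' k, pairedAutocov P v k
    have hs0 : 0 ≤ s := tsum_nonneg hd
    -- The bound comes from `(a + b / 2)² ≤ 2a² + b² / 2`, with room to spare.
    refine ⟨2 * s + ‖v‖ ^ 2 * 2, fun f => ?_⟩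
    have hE := inner_self_sub_apply_nonneg hP f
    set E := inner ℝ f (f - P f)
    -- Here `v = (1 - P) u + w` with `u` a partial Neumann sum. The remainder `w` need not vanish in
    -- the limit, so it is split as half of `(1 - P) w + (1 + P) w`: the Dirichlet form controls the
    -- first part, and the second tends to `0`.
    have h1 : ∀ m, |inner ℝ v f| ≤ √(s * E) + (√(2 * ‖v‖ ^ 2 * E) +
        √(2 * pairedAutocov P v (2 * m)) * ‖f‖) / 2 := by
      intro m
      set u := ∑ j ∈ Finset.range (2 * m), (P ^ j) v
      set w := (P ^ (2 * m)) v
      have e1 : u - P u = v - w := sub_apply_sum_pow P v _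
      have e2 : inner ℝ v f = inner ℝ (u - P u) f +
          (inner ℝ (w - P w) f + inner ℝ (w + P w) f) / 2 := by
        rw [e1]
        simp only [inner_sub_left, inner_add_left]
        ring
      have b1 : |inner ℝ (u - P u) f| ≤ √(s * E) := by
        refine Real.abs_le_sqrt ((inner_sub_apply_sq_le hs hP u f).trans ?_)
        gcongr
        exact (inner_sum_pow_sub_apply_le hs hP v m).trans (h.sum_le_tsum _ fun k _ => hd k)
      have b2 : |inner ℝ (w - P w) f| ≤ √(2 * ‖v‖ ^ 2 * E) := by
        refine Real.abs_le_sqrt ((inner_sub_apply_sq_le hs hP w f).trans ?_)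
        gcongr
        rw [inner_sub_right, real_inner_self_eq_norm_sq]
        have := neg_le_of_abs_le (abs_inner_apply_le hP w)
        have := pow_le_pow_left₀ (norm_nonneg _) (norm_pow_apply_le hP v (2 * m)) 2
        linarith
      have b3 : |inner ℝ (w + P w) f| ≤ √(2 * pairedAutocov P v (2 * m)) * ‖f‖ := by
        refine (abs_real_inner_le_norm _ _).trans ?_
        gcongr
        refine Real.le_sqrt_of_sq_le ((norm_add_apply_sq_le hP w).trans ?_)
        rw [pairedAutocov_eq hs]
      rw [e2]
      calc _ ≤ |inner ℝ (u - P u) f| + |(inner ℝ (w - P w) f + inner ℝ (w + P w) f) / 2| :=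
            abs_add_le _ _
        _ ≤ |inner ℝ (u - P u) f| + (|inner ℝ (w - P w) f| + |inner ℝ (w + P w) f|) / 2 := by
            rw [abs_div, abs_two]
            gcongr
            exact abs_add_le _ _
        _ ≤ _ := by gcongr
    have h2 : |inner ℝ v f| ≤ √(s * E) + √(2 * ‖v‖ ^ 2 * E) / 2 := by
      refine ge_of_tendsto' (x := atTop) ?_ h1
      have t : Tendsto (fun m => pairedAutocov P v (2 * m)) atTop (𝓝 0) :=
        h.tendsto_atTop_zero.comp (tendsto_id.const_mul_atTop' two_pos)
      have := ((t.const_mul 2).sqrt.mul_const ‖f‖).const_add (√(2 * ‖v‖ ^ 2 * E))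
      simpa using (this.div_const 2).const_add (√(s * E))
    have q1 := Real.sq_sqrt (mul_nonneg hs0 hE)
    have q2 := Real.sq_sqrt (show 0 ≤ 2 * ‖v‖ ^ 2 * E by positivity)
    have h3 := pow_le_pow_left₀ (abs_nonneg _) h2 2
    rw [sq_abs] at h3
    nlinarith [sq_nonneg (√(s * E) - √(2 * ‖v‖ ^ 2 * E) / 2),
      mul_nonneg (sq_nonneg ‖v‖) hE]
  · rintro ⟨C, hC⟩
    refine summable_of_sum_range_le hd (c := max C 0) fun m => ?_
    set s := ∑ k ∈ Finset.range m, pairedAutocov P v k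
    have hs0 : 0 ≤ s := Finset.sum_nonneg fun k _ => hd k
    -- Testing on the partial Neumann sum gives `s ^ 2 ≤ C * s`, since its pairing with `v` is `s`
    -- and its Dirichlet form is at most `s`.
    have h1 := hC (∑ j ∈ Finset.range (2 * m), (P ^ j) v)
    rw [inner_sum_pow] at h1
    have h2 := inner_sum_pow_sub_apply_le hs hP v m
    have h3 := inner_self_sub_apply_nonneg hP (∑ j ∈ Finset.range (2 * m), (P ^ j) v)
    by_contra! hlt
    have h4 : s ^ 2 ≤ max C 0 * s := h1.trans (by gcongr; exact le_max_left _ _)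
    have : 0 < s := (le_max_right _ _).trans_lt hlt
    nlinarith

/-- If the Dirichlet form is diagonal on a sequence `h` spanning a dense subspace, boundedness
with respect to it is a summability condition. -/
theorem exists_inner_sq_le_iff (v : H)
    (h : ℕ → H) (κ : ℕ → ℝ) (hκ : ∀ n, 0 < κ n)
    (hE : ∀ m n, inner ℝ (h m) (h n - P (h n)) = if m = n then κ n else 0)
    (hdense : (Submodule.span ℝ (Set.range h)).topologicalClosure = ⊤) :
    (∃ C, ∀ f, inner ℝ v f ^ 2 ≤ C * inner ℝ f (f - P f)) ↔
      Summable fun n => inner ℝ v (h n) ^ 2 / κ n := by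
  have hform : ∀ (s : Finset ℕ) (g : ℕ → ℝ),
      inner ℝ (∑ n ∈ s, g n • h n) ((∑ n ∈ s, g n • h n) - P (∑ n ∈ s, g n • h n)) =
        ∑ n ∈ s, κ n * g n ^ 2 := by
    intro s g
    have : (∑ n ∈ s, g n • h n) - P (∑ n ∈ s, g n • h n) = ∑ n ∈ s, g n • (h n - P (h n)) := by
      simp [map_sum, smul_sub, Finset.sum_sub_distrib]
    rw [this, sum_inner]
    simp_rw [inner_sum, inner_smul_left, inner_smul_right, hE]
    refine Finset.sum_congr rfl fun n hn => ?_
    simp only [mul_ite, mul_zero, Finset.sum_ite_eq, hn, if_true, RCLike.conj_to_real]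
    ring
  have hlin : ∀ (s : Finset ℕ) (g : ℕ → ℝ),
      inner ℝ v (∑ n ∈ s, g n • h n) = ∑ n ∈ s, g n * inner ℝ v (h n) := by
    intro s g
    simp [inner_sum, inner_smul_right]
  constructor
  · rintro ⟨C, hC⟩
    have hnn : ∀ n, 0 ≤ inner ℝ v (h n) ^ 2 / κ n := fun n => div_nonneg (sq_nonneg _) (hκ n).le
    refine summable_of_sum_range_le hnn (c := max C 0) fun m => ?_
    -- The optimal test vector: both its pairing with `v` and its Dirichlet form equal the partial
    -- sum `s`.
    have h1 := hC (∑ n ∈ Finset.range m, (inner ℝ v (h n) / κ n) • h n)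
    rw [hlin, hform] at h1
    have e1 : ∑ n ∈ Finset.range m, inner ℝ v (h n) / κ n * inner ℝ v (h n) =
        ∑ n ∈ Finset.range m, inner ℝ v (h n) ^ 2 / κ n :=
      Finset.sum_congr rfl fun n _ => by ring
    have e2 : ∑ n ∈ Finset.range m, κ n * (inner ℝ v (h n) / κ n) ^ 2 =
        ∑ n ∈ Finset.range m, inner ℝ v (h n) ^ 2 / κ n :=
      Finset.sum_congr rfl fun n _ => by
        have := (hκ n).ne'
        field_simp
    rw [e1, e2] at h1
    set s := ∑ n ∈ Finset.range m, inner ℝ v (h n) ^ 2 / κ n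
    have hs0 : 0 ≤ s := Finset.sum_nonneg fun k _ => hnn k
    by_contra! hlt
    have h4 : s ^ 2 ≤ max C 0 * s := h1.trans (by gcongr; exact le_max_left _ _)
    have : 0 < s := (le_max_right _ _).trans_lt hlt
    nlinarith
  · intro hsum
    refine ⟨∑' n, inner ℝ v (h n) ^ 2 / κ n, fun f => ?_⟩
    -- Both sides are continuous in `f`, so it suffices to prove the bound on the span, where it is
    -- a weighted Cauchy–Schwarz inequality.
    have hcl : IsClosed {f : H | inner ℝ v f ^ 2 ≤
        (∑' n, inner ℝ v (h n) ^ 2 / κ n) * inner ℝ f (f - P f)} :=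
      isClosed_le (by fun_prop) (by fun_prop)
    have hf : f ∈ closure (Submodule.span ℝ (Set.range h) : Set H) := by
      rw [← Submodule.topologicalClosure_coe, hdense]
      trivial
    refine hcl.closure_subset_iff.2 ?_ hf
    intro f hf
    obtain ⟨c, rfl⟩ := (Finsupp.mem_span_range_iff_exists_finsupp).1 hf
    rw [Set.mem_ofPred_eq, Finsupp.sum, hlin, hform]
    have e : ∀ n, c n * inner ℝ v (h n) =
        (inner ℝ v (h n) / √(κ n)) * (√(κ n) * c n) := by
      intro n
      have := (Real.sqrt_pos.2 (hκ n)).ne'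
      field_simp
    simp_rw [e]
    refine (Finset.sum_mul_sq_le_sq_mul_sq _ _ _).trans ?_
    have e3 : ∀ n, (√(κ n) * c n) ^ 2 = κ n * c n ^ 2 := fun n => by
      rw [mul_pow, Real.sq_sqrt (hκ n).le]
    have e4 : ∀ n, (inner ℝ v (h n) / √(κ n)) ^ 2 = inner ℝ v (h n) ^ 2 / κ n := fun n => by
      rw [div_pow, Real.sq_sqrt (hκ n).le]
    simp_rw [e3, e4]
    gcongr
    · exact Finset.sum_nonneg fun n _ => mul_nonneg (hκ n).le (sq_nonneg _)
    · exact hsum.sum_le_tsum _ fun n _ => div_nonneg (sq_nonneg _) (hκ n).le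

end SymmetricContraction

/-! ### Cesàro means and second moments of stationary sums. -/

theorem tendsto_of_even_odd {X : Type*} [TopologicalSpace X] {u : ℕ → X} {x : X}
    (h0 : Tendsto (fun n => u (2 * n)) atTop (𝓝 x))
    (h1 : Tendsto (fun n => u (2 * n + 1)) atTop (𝓝 x)) : Tendsto u atTop (𝓝 x) := by
  rw [tendsto_def] at *
  intro s hs
  obtain ⟨a, ha⟩ := mem_atTop_sets.1 (h0 s hs)
  obtain ⟨b, hb⟩ := mem_atTop_sets.1 (h1 s hs)
  refine mem_atTop_sets.2 ⟨2 * a + 2 * b, fun n hn => ?_⟩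
  rcases Nat.even_or_odd' n with ⟨k, rfl | rfl⟩
  · exact ha k (by omega)
  · exact hb k (by omega)

/-- Covers sequences oscillating between two limits: summing `b i + b (i + 1)` counts each term
twice, up to the bounded boundary term `b n - b 0`. -/
theorem tendsto_cesaro_of_add_succ {b : ℕ → ℝ} {l B : ℝ} (hB : ∀ n, |b n| ≤ B)
    (h : Tendsto (fun n => b n + b (n + 1)) atTop (𝓝 l)) :
    Tendsto (fun n : ℕ => (n : ℝ)⁻¹ * ∑ i ∈ Finset.range n, b i) atTop (𝓝 (l / 2)) := by
  have hb : Tendsto (fun n : ℕ => (n : ℝ)⁻¹ * (b n - b 0)) atTop (𝓝 0) := by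
    refine bdd_le_mul_tendsto_zero' (2 * B) (.of_forall fun n => ?_) tendsto_inv_atTop_nhds_zero_nat
      |>.congr fun n => mul_comm _ _
    refine (abs_sub _ _).trans ?_
    linarith [hB n, hB 0]
  have := (h.cesaro.sub hb).div_const 2
  rw [sub_zero] at this
  refine this.congr fun n => ?_
  have e : ∑ i ∈ Finset.range n, (b i + b (i + 1)) =
      2 * ∑ i ∈ Finset.range n, b i + (b n - b 0) := by
    rw [Finset.sum_add_distrib, ← Finset.sum_range_sub]
    rw [Finset.sum_sub_distrib]
    ring
  rw [e]
  ring

theorem tendsto_cesaro_atTop {b : ℕ → ℝ} (h : Tendsto b atTop atTop) :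
    Tendsto (fun n : ℕ => (n : ℝ)⁻¹ * ∑ i ∈ Finset.range n, b i) atTop atTop := by
  refine tendsto_atTop.2 fun K => ?_
  have h1 : Tendsto (fun n => min (b n) (K + 1)) atTop (𝓝 (K + 1)) := by
    refine tendsto_const_nhds.congr' ?_
    filter_upwards [h.eventually_ge_atTop (K + 1)] with n hn
    rw [min_eq_right hn]
  filter_upwards [h1.cesaro.eventually (lt_mem_nhds (lt_add_one K))] with n hn
  refine hn.le.trans ?_
  gcongr
  exact min_le_left _ _

theorem norm_sum_range_sq_of_stationary {K : Type*} [NormedAddCommGroup K] [InnerProductSpace ℝ K]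
    {v : ℕ → K} {a : ℕ → ℝ} (hv : ∀ i k, inner ℝ (v i) (v (i + k)) = a k) (n : ℕ) :
    ‖∑ i ∈ Finset.range n, v i‖ ^ 2 =
      ∑ i ∈ Finset.range n, (2 * ∑ k ∈ Finset.range (i + 1), a k - a 0) := by
  induction n with
  | zero => simp
  | succ n ih =>
    have e : inner ℝ (∑ i ∈ Finset.range n, v i) (v n) = ∑ k ∈ Finset.range n, a (k + 1) := by
      rw [sum_inner, ← Finset.sum_range_reflect (fun k => a (k + 1))]
      refine Finset.sum_congr rfl fun i hi => ?_
      have hi := Finset.mem_range.1 hi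
      rw [← hv i]
      congr 2
      omega
    have e0 : ‖v n‖ ^ 2 = a 0 := by rw [← real_inner_self_eq_norm_sq, ← hv n 0, add_zero]
    rw [Finset.sum_range_succ, norm_add_sq_real, ih, e, e0, Finset.sum_range_succ _ n,
      Finset.sum_range_succ' a n]
    ring

/-! ### Asymptotic variance under a symmetric contraction. -/

section SymmetricContraction

variable {H : Type*} [NormedAddCommGroup H] [InnerProductSpace ℝ H] {P : H →L[ℝ] H}

theorem abs_autocov_le (hP : ∀ x, ‖P x‖ ≤ ‖x‖) (v : H) (k : ℕ) : |autocov P v k| ≤ ‖v‖ ^ 2 := by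
  calc |autocov P v k| ≤ ‖v‖ * ‖(P ^ k) v‖ := abs_real_inner_le_norm _ _
    _ ≤ ‖v‖ * ‖v‖ := by gcongr; exact norm_pow_apply_le hP v k
    _ = ‖v‖ ^ 2 := by ring

/-- The partial sums of the autocovariances, up to an error bounded by the variance, are those of
the paired autocovariances. -/
theorem abs_sum_range_autocov_sub_le (hP : ∀ x, ‖P x‖ ≤ ‖x‖) (v : H) (n : ℕ) :
    |∑ k ∈ Finset.range n, autocov P v k - ∑ k ∈ Finset.range (n / 2), pairedAutocov P v k| ≤
      ‖v‖ ^ 2 := by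
  rcases Nat.even_or_odd' n with ⟨k, rfl | rfl⟩
  · rw [sum_range_two_mul_autocov, Nat.mul_div_cancel_left k two_pos, sub_self, abs_zero]
    positivity
  · rw [Finset.sum_range_succ, sum_range_two_mul_autocov, show (2 * k + 1) / 2 = k by omega,
      add_sub_cancel_left]
    exact abs_autocov_le hP v _

/-- The partial sums may alternate between two limits that differ by `a = lim autocov P v (2 * k)`.
Two consecutive ones always contain one of each parity, so their sum tends to `2 * ∑' k,
pairedAutocov P v k + a`. -/
theorem tendsto_sum_range_autocov_add_succ (hs : ∀ x y, inner ℝ (P x) y = inner ℝ x (P y))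
    (hP : ∀ x, ‖P x‖ ≤ ‖x‖) (v : H) (h : Summable (pairedAutocov P v)) :
    ∃ l, Tendsto (fun n => ∑ k ∈ Finset.range n, autocov P v k +
      ∑ k ∈ Finset.range (n + 1), autocov P v k) atTop (𝓝 l) := by
  obtain ⟨a, ha⟩ := exists_tendsto_autocov_two_mul hs hP v
  have hsum := h.hasSum.tendsto_sum_nat
  refine ⟨2 * (∑' k, pairedAutocov P v k) + a, tendsto_of_even_odd ?_ ?_⟩
  · refine ((hsum.const_mul 2).add ha).congr fun n => ?_
    rw [Finset.sum_range_succ, sum_range_two_mul_autocov]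
    ring
  · have := ((hsum.comp (tendsto_add_atTop_nat 1)).add (hsum.add ha))
    rw [show 2 * (∑' k, pairedAutocov P v k) + a = (∑' k, pairedAutocov P v k) +
      ((∑' k, pairedAutocov P v k) + a) by ring]
    refine this.congr fun n => ?_
    rw [show 2 * n + 1 + 1 = 2 * (n + 1) by ring, sum_range_two_mul_autocov,
      Finset.sum_range_succ _ (2 * n), sum_range_two_mul_autocov, Function.comp_apply]
    ring

/-- The asymptotic variance of a stationary sequence whose covariances are the autocovariances
of a vector under a symmetric contraction. -/
theorem exists_tendsto_norm_sum_sq_div {K : Type*} [NormedAddCommGroup K] [InnerProductSpace ℝ K]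
    (hs : ∀ x y, inner ℝ (P x) y = inner ℝ x (P y)) (hP : ∀ x, ‖P x‖ ≤ ‖x‖) (v : H)
    {w : ℕ → K} (hw : ∀ i k, inner ℝ (w i) (w (i + k)) = autocov P v k) :
    ∃ D : ℝ≥0∞, Tendsto (fun N : ℕ => ENNReal.ofReal (‖∑ n ∈ Finset.range (N + 1), w n‖ ^ 2) /
      (N : ℝ≥0∞)) atTop (𝓝 D) ∧ (D < ⊤ ↔ Summable (pairedAutocov P v)) := by
  set b : ℕ → ℝ := fun i => 2 * ∑ k ∈ Finset.range (i + 1), autocov P v k - autocov P v 0 with hb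
  have hnorm : ∀ n, ‖∑ i ∈ Finset.range n, w i‖ ^ 2 = ∑ i ∈ Finset.range n, b i :=
    norm_sum_range_sq_of_stationary hw
  have hratio : Tendsto (fun N : ℕ => 1 + (N : ℝ)⁻¹) atTop (𝓝 1) := by
    simpa using tendsto_inv_atTop_nhds_zero_nat (𝕜 := ℝ).const_add 1
  -- The sum has `N + 1` terms but is divided by `N`; the factor `1 + N⁻¹` makes up the difference.
  have heq : ∀ᶠ N : ℕ in atTop,
      ENNReal.ofReal ((((N + 1 : ℕ) : ℝ)⁻¹ * ∑ i ∈ Finset.range (N + 1), b i) * (1 + (N : ℝ)⁻¹)) =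
      ENNReal.ofReal (‖∑ n ∈ Finset.range (N + 1), w n‖ ^ 2) / (N : ℝ≥0∞) := by
    filter_upwards [eventually_gt_atTop 0] with N hN
    have hN' : (0 : ℝ) < N := by exact_mod_cast hN
    rw [← ENNReal.ofReal_natCast, ← ENNReal.ofReal_div_of_pos hN', hnorm]
    congr 1
    push_cast
    field_simp
  have hd := pairedAutocov_nonneg hs hP v
  by_cases h : Summable (pairedAutocov P v)
  · obtain ⟨l, hl⟩ := tendsto_sum_range_autocov_add_succ hs hP v h
    have hB : ∀ n, |b n| ≤ 2 * ∑' k, pairedAutocov P v k + 3 * ‖v‖ ^ 2 := by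
      intro n
      have h1 := abs_le.1 (abs_sum_range_autocov_sub_le hP v (n + 1))
      have h2 := abs_le.1 (abs_autocov_le hP v 0)
      have h3 := h.sum_le_tsum (Finset.range ((n + 1) / 2)) fun k _ => hd k
      have h4 := Finset.sum_nonneg fun k (_ : k ∈ Finset.range ((n + 1) / 2)) => hd k
      simp only [hb]
      exact abs_le.2 ⟨by linarith, by linarith⟩
    have hbl : Tendsto (fun n => b n + b (n + 1)) atTop (𝓝 (2 * l - 2 * autocov P v 0)) := by
      refine (((hl.comp (tendsto_add_atTop_nat 1)).const_mul 2).sub_const _).congr fun n => ?_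
      simp only [hb, Function.comp_apply]
      ring
    have hces := ((tendsto_cesaro_of_add_succ hB hbl).comp (tendsto_add_atTop_nat 1)).mul hratio
    exact ⟨_, (ENNReal.tendsto_ofReal hces).congr' heq, iff_of_true ENNReal.ofReal_lt_top h⟩
  · have hs_top : Tendsto (fun n => ∑ k ∈ Finset.range n, pairedAutocov P v k) atTop atTop :=
      (not_summable_iff_tendsto_nat_atTop_of_nonneg hd).1 h
    have hbtop : Tendsto b atTop atTop := by
      have h0 : Tendsto (fun n : ℕ => (n + 1) / 2) atTop atTop :=
        (Nat.tendsto_div_const_atTop two_ne_zero).comp (tendsto_add_atTop_nat 1)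
      refine tendsto_atTop_mono (fun n => ?_) (tendsto_atTop_add_const_right _ (-3 * ‖v‖ ^ 2)
        ((hs_top.comp h0).const_mul_atTop two_pos))
      have h1 := abs_le.1 (abs_sum_range_autocov_sub_le hP v (n + 1))
      have h2 := abs_le.1 (abs_autocov_le hP v 0)
      simp only [hb, Function.comp_apply]
      linarith
    have hces := ((tendsto_cesaro_atTop hbtop).comp (tendsto_add_atTop_nat 1)).atTop_mul_pos
      one_pos hratio
    exact ⟨_, (ENNReal.tendsto_ofReal_atTop.comp hces).congr' heq,
      iff_of_false (lt_irrefl _) h⟩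

end SymmetricContraction

/-! ### Reversibility and the bound on the right-step probabilities. -/

namespace IsBirthDeathMatrix

variable {p : ℕ → ℕ → ℝ}

theorem pos_right (hp : IsBirthDeathMatrix p) (x : ℕ) : 0 < p x (x + 1) :=
  (hp.nonneg _ _).lt_of_ne' fun h => (hp.zero_iff _ _).1 h (Or.inl rfl)

theorem pos_left (hp : IsBirthDeathMatrix p) (x : ℕ) : 0 < p (x + 1) x :=
  (hp.nonneg _ _).lt_of_ne' fun h => (hp.zero_iff _ _).1 h (Or.inr rfl)

theorem le_one (hp : IsBirthDeathMatrix p) (x y : ℕ) : p x y ≤ 1 := by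
  rw [← (hp.row_sum x).tsum_eq]
  exact (hp.row_sum x).summable.le_tsum y fun z _ => hp.nonneg x z

theorem sum_range_add_two (hp : IsBirthDeathMatrix p) (x n : ℕ) (hn : x + 2 ≤ n) :
    ∑ y ∈ Finset.range n, p x y = 1 := by
  refine (hasSum_sum_of_ne_finset_zero fun y hy => ?_).unique (hp.row_sum x)
  rw [Finset.mem_range] at hy
  exact (hp.zero_iff x y).2 (by omega)

/-- The segment `[0, n]` can be left in one step only from its endpoint `n`; this is what
diagonalizes the Dirichlet form. -/
theorem sum_range_succ_of_le (hp : IsBirthDeathMatrix p) {x n : ℕ} (hn : x ≤ n) :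
    ∑ y ∈ Finset.range (n + 1), p x y = 1 - if x = n then p n (n + 1) else 0 := by
  split_ifs with h
  · have := hp.sum_range_add_two n (n + 2) le_rfl
    rw [Finset.sum_range_succ] at this
    subst h
    linarith
  · rw [hp.sum_range_add_two x (n + 1) (by omega), sub_zero]

theorem reversibleMeasure_pos (hp : IsBirthDeathMatrix p) (x : ℕ) : 0 < reversibleMeasure p x := by
  refine Finset.prod_pos fun k hk => ?_
  obtain ⟨k, rfl⟩ := Nat.exists_eq_add_of_le' (Finset.mem_Icc.1 hk).1
  exact div_pos (hp.pos_right k) (hp.pos_left k)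

theorem reversibleMeasure_succ_mul (hp : IsBirthDeathMatrix p) (x : ℕ) :
    reversibleMeasure p (x + 1) * p (x + 1) x = reversibleMeasure p x * p x (x + 1) := by
  have := (hp.pos_left x).ne'
  rw [reversibleMeasure, Finset.prod_Icc_succ_top (by omega), ← reversibleMeasure,
    Nat.add_sub_cancel]
  field_simp

theorem detailed_balance (hp : IsBirthDeathMatrix p) (x y : ℕ) :
    invariantLaw p x * p x y = invariantLaw p y * p y x := by
  simp only [invariantLaw, div_mul_eq_mul_div]
  congr 1
  by_cases h1 : y = x + 1
  · rw [h1, hp.reversibleMeasure_succ_mul]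
  by_cases h2 : x = y + 1
  · rw [h2, hp.reversibleMeasure_succ_mul]
  rw [(hp.zero_iff x y).2 (by omega), (hp.zero_iff y x).2 (by omega), mul_zero, mul_zero]

theorem invariantLaw_nonneg (hp : IsBirthDeathMatrix p) (x : ℕ) : 0 ≤ invariantLaw p x :=
  div_nonneg (hp.reversibleMeasure_pos x).le (tsum_nonneg fun y => (hp.reversibleMeasure_pos y).le)

end IsBirthDeathMatrix

theorem HasWeakLeftDrift.exists_forall_inv_le {p : ℕ → ℕ → ℝ} {c : ℕ → ℝ} {α : ℝ} (hα : 0 < α)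
    (hc : HasWeakLeftDrift p c α) :
    ∃ B, ∀ x, (p x (x + 1))⁻¹ ≤ B := by
  obtain ⟨M, hM, -⟩ := EReal.lt_iff_exists_real_btwn.1 hc.limsup_lt_top
  have h1 := eventually_lt_of_limsup_lt hM
  have h2 : Tendsto (fun x : ℕ => (x : ℝ) ^ α) atTop atTop :=
    (tendsto_rpow_atTop hα).comp tendsto_natCast_atTop_atTop
  have h3 : ∀ᶠ x in atTop, (p x (x + 1))⁻¹ ≤ 4 := by
    -- Once `x ^ α ≥ 4 * |M| + 1`, having `c x > 1 / 4` would force `c x * x ^ α > M`.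
    filter_upwards [h1, h2.eventually_ge_atTop (4 * |M| + 1), eventually_ge_atTop 1]
      with x hx1 hx2 hx3
    rw [EReal.coe_lt_coe_iff] at hx1
    have h4 : c x ≤ 1 / 4 := by
      by_contra! h
      have := le_abs_self M
      have := abs_nonneg M
      nlinarith
    rw [hc.right x hx3]
    exact inv_le_of_inv_le₀ (by norm_num) (by linarith)
  obtain ⟨B, hB⟩ := (isBoundedUnder_of_eventually_le h3).bddAbove_range
  exact ⟨B, fun x => hB ⟨x, rfl⟩⟩

/-! ### Markov property and stationarity. -/

namespace IsMarkovChain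

variable {Ω : Type*} [MeasurableSpace Ω] {μ : Measure Ω} {p : ℕ → ℕ → ℝ} {X : ℕ → Ω → ℕ}

theorem measure_path_inter [IsFiniteMeasure μ] (hX : IsMarkovChain μ p X) (n : ℕ) (x : ℕ → ℕ) :
    μ ({ω | ∀ i ≤ n, X i ω = x i} ∩ {ω | X (n + 1) ω = x (n + 1)}) =
      μ {ω | ∀ i ≤ n, X i ω = x i} * ENNReal.ofReal (p (x n) (x (n + 1))) := by
  by_cases h : μ {ω | ∀ i ≤ n, X i ω = x i} = 0
  · rw [h, zero_mul]
    exact measure_mono_null Set.inter_subset_left h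
  · have hm : MeasurableSet {ω | ∀ i ≤ n, X i ω = x i} := by
      have : {ω | ∀ i ≤ n, X i ω = x i} = ⋂ i, ⋂ (_ : i ≤ n), X i ⁻¹' {x i} := by
        ext ω
        simp
      rw [this]
      exact .iInter fun i => .iInter fun _ => hX.measurable i (measurableSet_singleton _)
    rw [← hX.step n x h, cond_apply hm, ← mul_assoc, ENNReal.mul_inv_cancel h (measure_ne_top _ _),
      one_mul]

/-- The Markov property relative to the state at one earlier time. -/
theorem measure_inter_inter [IsFiniteMeasure μ] (hX : IsMarkovChain μ p X) {i n : ℕ} (hi : i ≤ n)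
    (a b y : ℕ) :
    μ ((X i ⁻¹' {a} ∩ X n ⁻¹' {b}) ∩ X (n + 1) ⁻¹' {y}) =
      μ (X i ⁻¹' {a} ∩ X n ⁻¹' {b}) * ENNReal.ofReal (p b y) := by
  set Y : Ω → Fin (n + 1) → ℕ := fun ω j => X j ω with hY
  have hYm : Measurable Y := measurable_pi_lambda _ fun j => hX.measurable j
  set S : Set (Fin (n + 1) → ℕ) := {s | s ⟨i, by omega⟩ = a ∧ s (Fin.last n) = b} with hS
  have e : X i ⁻¹' {a} ∩ X n ⁻¹' {b} = Y ⁻¹' S := by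
    ext ω
    simp [hY, hS]
  have hT : MeasurableSet (X (n + 1) ⁻¹' {y}) := hX.measurable _ (measurableSet_singleton y)
  have hfib : ∀ s : Fin (n + 1) → ℕ, MeasurableSet (Y ⁻¹' {s}) := fun s =>
    hYm (measurableSet_singleton s)
  rw [e, ← Measure.restrict_apply' hT,
    ← tsum_measure_preimage_singleton (μ := μ) S.to_countable fun s _ => hfib s,
    ← tsum_measure_preimage_singleton (μ := μ.restrict _) S.to_countable fun s _ => hfib s,
    ← ENNReal.tsum_mul_right]
  refine tsum_congr fun ⟨s, hs⟩ => ?_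
  rw [Measure.restrict_apply' hT]
  -- The event is cut into full histories `s`, the only ones the Markov hypothesis speaks about;
  -- each is extended by `y` at time `n + 1`.
  have key := hX.measure_path_inter n fun j => if h : j < n + 1 then s ⟨j, h⟩ else y
  have e1 : {ω | ∀ j ≤ n, X j ω = if h : j < n + 1 then s ⟨j, h⟩ else y} = Y ⁻¹' {s} := by
    ext ω
    simp only [Set.mem_preimage, Set.mem_singleton_iff, funext_iff, hY, Fin.forall_iff]
    refine forall_congr' fun j => ?_
    rw [← Nat.lt_succ_iff]
    refine forall_congr' fun hj => ?_
    rw [dif_pos hj]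
  simp only [e1, lt_irrefl, dif_neg, not_false_eq_true, lt_add_one, dif_pos] at key
  have hb : s ⟨n, lt_add_one n⟩ = b := hs.2
  rw [hb] at key
  exact key

theorem measure_inter_succ [IsFiniteMeasure μ] (hX : IsMarkovChain μ p X) {i n : ℕ} (hi : i ≤ n)
    (a y : ℕ) :
    μ (X i ⁻¹' {a} ∩ X (n + 1) ⁻¹' {y}) =
      ∑' b, μ (X i ⁻¹' {a} ∩ X n ⁻¹' {b}) * ENNReal.ofReal (p b y) := by
  simp_rw [← hX.measure_inter_inter hi]
  have hm : ∀ j z, MeasurableSet (X j ⁻¹' {z}) := fun j z =>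
    hX.measurable j (measurableSet_singleton z)
  rw [← measure_iUnion]
  · congr 1
    ext ω
    simp
  · intro b b' hb
    refine Set.disjoint_left.2 fun ω h1 h2 => hb ?_
    exact h1.1.2.symm.trans h2.1.2
  · exact fun b => ((hm _ _).inter (hm _ _)).inter (hm _ _)

/-- Started from the invariant law, a birth and death chain is stationary. -/
theorem measure_eq_invariantLaw [IsFiniteMeasure μ] (hX : IsMarkovChain μ p X)
    (hp : IsBirthDeathMatrix p)
    (hX0 : ∀ x, μ {ω | X 0 ω = x} = ENNReal.ofReal (invariantLaw p x)) (n y : ℕ) :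
    μ (X n ⁻¹' {y}) = ENNReal.ofReal (invariantLaw p y) := by
  induction n generalizing y with
  | zero => exact hX0 y
  | succ n ih =>
    have hm : ∀ j z, MeasurableSet (X j ⁻¹' {z}) := fun j z =>
      hX.measurable j (measurableSet_singleton z)
    have h1 : μ (X (n + 1) ⁻¹' {y}) = ∑' b, μ (X n ⁻¹' {b}) * ENNReal.ofReal (p b y) := by
      have h2 : ∀ b, μ (X n ⁻¹' {b}) * ENNReal.ofReal (p b y) =
          μ (X n ⁻¹' {b} ∩ X (n + 1) ⁻¹' {y}) := fun b => by
        have := hX.measure_inter_inter (le_refl n) b b y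
        rw [Set.inter_self] at this
        exact this.symm
      simp_rw [h2]
      rw [← measure_iUnion]
      · congr 1
        ext ω
        simp
      · intro b b' hb
        refine Set.disjoint_left.2 fun ω h1 h2 => hb ?_
        exact h1.1.symm.trans h2.1
      · exact fun b => (hm _ _).inter (hm _ _)
    -- Detailed balance turns the sum over predecessors of `y` into `π(y)` times a row sum.
    simp_rw [h1, ih, ← ENNReal.ofReal_mul (hp.invariantLaw_nonneg _), hp.detailed_balance _ y,
      ENNReal.ofReal_mul (hp.invariantLaw_nonneg y)]
    rw [ENNReal.tsum_mul_left, ← ENNReal.ofReal_tsum_of_nonneg (hp.nonneg y)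
      (hp.row_sum y).summable, (hp.row_sum y).tsum_eq, ENNReal.ofReal_one, mul_one]

/-- The normalizing sum is nonzero because `X 0` has total mass one: were it `0`, the default value
for a divergent series, then `invariantLaw` would vanish identically. -/
theorem invariantLaw_pos [IsProbabilityMeasure μ] (hX : IsMarkovChain μ p X)
    (hp : IsBirthDeathMatrix p)
    (hX0 : ∀ x, μ {ω | X 0 ω = x} = ENNReal.ofReal (invariantLaw p x)) (x : ℕ) :
    0 < invariantLaw p x := by
  have hZ : ∑' y, reversibleMeasure p y ≠ 0 := by
    intro hZ
    have h0 : ∀ y ∈ Set.univ, μ (X 0 ⁻¹' {y}) = 0 := fun y _ => by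
      rw [hX.measure_eq_invariantLaw hp hX0, invariantLaw, hZ, div_zero, ENNReal.ofReal_zero]
    have := (measure_preimage_eq_zero_iff_of_countable Set.countable_univ).2 h0
    simp at this
  exact div_pos (hp.reversibleMeasure_pos x)
    ((tsum_nonneg fun y => (hp.reversibleMeasure_pos y).le).lt_of_ne' hZ)

theorem measurePreserving [IsFiniteMeasure μ] (hX : IsMarkovChain μ p X)
    (hp : IsBirthDeathMatrix p)
    (hX0 : ∀ x, μ {ω | X 0 ω = x} = ENNReal.ofReal (invariantLaw p x)) (n : ℕ) :
    MeasurePreserving (X n) μ (μ.map (X 0)) := by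
  refine ⟨hX.measurable n, Measure.ext_of_singleton fun y => ?_⟩
  rw [Measure.map_apply (hX.measurable n) (measurableSet_singleton y),
    Measure.map_apply (hX.measurable 0) (measurableSet_singleton y),
    hX.measure_eq_invariantLaw hp hX0, hX.measure_eq_invariantLaw hp hX0]

end IsMarkovChain

/-! ### `L²` of a law on `ℕ` and transition operators. -/

section CountableLp

/-- The indicator of a point, in `L²`. -/
noncomputable def pointIndicator (ν : Measure ℕ) [IsFiniteMeasure ν] (y : ℕ) : Lp ℝ 2 ν :=
  indicatorConstLp 2 (measurableSet_singleton y) (measure_ne_top ν {y}) 1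

variable {ν : Measure ℕ} [IsFiniteMeasure ν]

theorem inner_pointIndicator (x : ℕ) (f : Lp ℝ 2 ν) :
    inner ℝ (pointIndicator ν x) f = ν.real {x} * f x := by
  rw [pointIndicator, L2.inner_indicatorConstLp_one, integral_singleton, smul_eq_mul]

theorem inner_pointIndicator_pointIndicator (x y : ℕ) :
    inner ℝ (pointIndicator ν x) (pointIndicator ν y) = if x = y then ν.real {x} else 0 := by
  rw [pointIndicator, pointIndicator, L2.real_inner_indicatorConstLp_one_indicatorConstLp_one]
  split_ifs with h
  · rw [h, Set.inter_self]
  · rw [Set.singleton_inter_eq_empty.2 (by simpa using h), measureReal_empty]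

theorem eq_of_forall_inner_pointIndicator {f g : Lp ℝ 2 ν}
    (h : ∀ x, inner ℝ (pointIndicator ν x) f = inner ℝ (pointIndicator ν x) g) : f = g := by
  refine Lp.ext ?_
  rw [Filter.EventuallyEq, ae_iff_of_countable]
  intro x hx
  have := h x
  rw [inner_pointIndicator, inner_pointIndicator] at this
  exact mul_left_cancel₀ ((measureReal_ne_zero_iff (measure_ne_top _ _)).2 hx) this

theorem topologicalClosure_span_pointIndicator :
    (Submodule.span ℝ (Set.range (pointIndicator ν))).topologicalClosure = ⊤ := by
  rw [Submodule.topologicalClosure_eq_top_iff, Submodule.eq_bot_iff]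
  intro f hf
  refine eq_of_forall_inner_pointIndicator fun x => ?_
  rw [inner_zero_right]
  exact hf _ (Submodule.subset_span ⟨x, rfl⟩)

theorem continuousLinearMap_ext_pointIndicator {A B : Lp ℝ 2 ν →L[ℝ] Lp ℝ 2 ν}
    (h : ∀ x y, inner ℝ (pointIndicator ν x) (A (pointIndicator ν y)) =
      inner ℝ (pointIndicator ν x) (B (pointIndicator ν y))) : A = B := by
  refine ContinuousLinearMap.ext_on (s := Set.range (pointIndicator ν)) ?_ ?_
  · rw [dense_iff_closure_eq, ← Submodule.topologicalClosure_coe,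
      topologicalClosure_span_pointIndicator, Submodule.top_coe]
  · rintro _ ⟨y, rfl⟩
    exact eq_of_forall_inner_pointIndicator fun x => h x y

/-- The indicator of an initial segment, in `L²`. -/
noncomputable def initialIndicator (ν : Measure ℕ) [IsFiniteMeasure ν] (n : ℕ) : Lp ℝ 2 ν :=
  ∑ x ∈ Finset.range (n + 1), pointIndicator ν x

theorem topologicalClosure_span_initialIndicator :
    (Submodule.span ℝ (Set.range (initialIndicator ν))).topologicalClosure = ⊤ := by
  rw [eq_top_iff, ← topologicalClosure_span_pointIndicator]
  refine Submodule.topologicalClosure_mono (Submodule.span_le.2 ?_)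
  rintro _ ⟨x, rfl⟩
  have hmem : ∀ n, initialIndicator ν n ∈ Submodule.span ℝ (Set.range (initialIndicator ν)) :=
    fun n => Submodule.subset_span ⟨n, rfl⟩
  cases x with
  | zero => simpa [initialIndicator] using hmem 0
  | succ x =>
    have := Submodule.sub_mem _ (hmem (x + 1)) (hmem x)
    rwa [initialIndicator, initialIndicator, Finset.sum_range_succ _ (x + 1),
      add_sub_cancel_left] at this

variable {Ω : Type*} [MeasurableSpace Ω] {μ : Measure Ω} [IsFiniteMeasure μ]

theorem inner_comp_pointIndicator {X Y : Ω → ℕ} (hX : MeasurePreserving X μ ν)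
    (hY : MeasurePreserving Y μ ν) (x y : ℕ) :
    inner ℝ (Lp.compMeasurePreservingₗᵢ ℝ X hX (pointIndicator ν x))
      (Lp.compMeasurePreservingₗᵢ ℝ Y hY (pointIndicator ν y)) =
      μ.real (X ⁻¹' {x} ∩ Y ⁻¹' {y}) := by
  exact L2.real_inner_indicatorConstLp_one_indicatorConstLp_one
    (hX.measurable (measurableSet_singleton x)) (hY.measurable (measurableSet_singleton y))

/-- The operator of conditional expectation of a function of `Y` given `X`, when both variables
have the same law. -/
noncomputable def transitionOperator {X Y : Ω → ℕ} (hX : MeasurePreserving X μ ν)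
    (hY : MeasurePreserving Y μ ν) : Lp ℝ 2 ν →L[ℝ] Lp ℝ 2 ν :=
  ContinuousLinearMap.adjoint (Lp.compMeasurePreservingₗᵢ ℝ X hX).toContinuousLinearMap ∘L
    (Lp.compMeasurePreservingₗᵢ ℝ Y hY).toContinuousLinearMap

variable {X Y : Ω → ℕ} (hX : MeasurePreserving X μ ν) (hY : MeasurePreserving Y μ ν)

omit [IsFiniteMeasure ν] [IsFiniteMeasure μ] in
theorem inner_transitionOperator (f g : Lp ℝ 2 ν) :
    inner ℝ f (transitionOperator hX hY g) =
      inner ℝ (Lp.compMeasurePreservingₗᵢ ℝ X hX f) (Lp.compMeasurePreservingₗᵢ ℝ Y hY g) := by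
  rw [transitionOperator, ContinuousLinearMap.comp_apply, ContinuousLinearMap.adjoint_inner_right]
  rfl

omit [IsFiniteMeasure ν] [IsFiniteMeasure μ] in
theorem norm_transitionOperator_le (f : Lp ℝ 2 ν) : ‖transitionOperator hX hY f‖ ≤ ‖f‖ := by
  set g := transitionOperator hX hY f with hg
  have h : ‖g‖ * ‖g‖ ≤ ‖g‖ * ‖f‖ := by
    rw [← real_inner_self_eq_norm_mul_norm]
    nth_rw 2 [hg]
    rw [inner_transitionOperator]
    refine (real_inner_le_norm _ _).trans ?_
    rw [LinearIsometry.norm_map, LinearIsometry.norm_map]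
  rcases (norm_nonneg g).eq_or_lt with h0 | h0
  · rw [← h0]
    positivity
  · exact le_of_mul_le_mul_left h h0

omit [IsFiniteMeasure ν] [IsFiniteMeasure μ] in
theorem transitionOperator_self : transitionOperator hX hX = 1 := by
  refine ContinuousLinearMap.ext fun g => ext_inner_left ℝ fun f => ?_
  rw [inner_transitionOperator, LinearIsometry.inner_map_map]
  rfl

/-- Symmetry of the joint law is reversibility. A bounded operator is determined by its entries on
point indicators, so comparing those with the entries of the adjoint is enough. -/
theorem transitionOperator_symm
    (h : ∀ x y, μ.real (X ⁻¹' {x} ∩ Y ⁻¹' {y}) = μ.real (X ⁻¹' {y} ∩ Y ⁻¹' {x}))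
    (f g : Lp ℝ 2 ν) :
    inner ℝ (transitionOperator hX hY f) g = inner ℝ f (transitionOperator hX hY g) := by
  have : ContinuousLinearMap.adjoint (transitionOperator hX hY) = transitionOperator hX hY := by
    refine continuousLinearMap_ext_pointIndicator fun x y => ?_
    rw [ContinuousLinearMap.adjoint_inner_right, real_inner_comm, inner_transitionOperator,
      inner_transitionOperator, inner_comp_pointIndicator, inner_comp_pointIndicator, h]
  conv_lhs => rw [← this]
  rw [ContinuousLinearMap.adjoint_inner_left]

theorem inner_toLp_initialIndicator {V : ℕ → ℝ} (hV : MemLp V 2 ν) (n : ℕ) :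
    inner ℝ (hV.toLp V) (initialIndicator ν n) =
      ∑ x ∈ Finset.range (n + 1), V x * ν.real {x} := by
  rw [initialIndicator, inner_sum]
  refine Finset.sum_congr rfl fun x _ => ?_
  rw [real_inner_comm, inner_pointIndicator]
  -- The `L²` class determines `V x` only at points of positive mass; at the others both sides
  -- vanish.
  by_cases hx : ν {x} = 0
  · simp [measureReal_def, hx]
  · rw [ae_iff_of_countable.1 hV.coeFn_toLp x hx, mul_comm]

theorem memLp_two_of_summable {V : ℕ → ℝ} (hV : Summable fun x => V x ^ 2 * ν.real {x}) :
    MemLp V 2 ν := by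
  rw [memLp_two_iff_integrable_sq (measurable_of_countable V).aestronglyMeasurable]
  refine ⟨(measurable_of_countable _).aestronglyMeasurable, ?_⟩
  rw [hasFiniteIntegral_iff_enorm, lintegral_countable']
  convert hV.tsum_ofReal_lt_top using 3 with x
  rw [ENNReal.ofReal_mul (sq_nonneg _), Real.enorm_of_nonneg (sq_nonneg _), ofReal_measureReal]

omit [IsFiniteMeasure ν] [IsFiniteMeasure μ] in
theorem ofReal_norm_sq_sum_comp {X : ℕ → Ω → ℕ} (hX : ∀ n, MeasurePreserving (X n) μ ν)
    {V : ℕ → ℝ} (hV : MemLp V 2 ν) (N : ℕ) :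
    ENNReal.ofReal
      (‖∑ n ∈ Finset.range N, Lp.compMeasurePreservingₗᵢ ℝ (X n) (hX n) (hV.toLp V)‖ ^ 2) =
      ∫⁻ ω, ENNReal.ofReal ((∑ n ∈ Finset.range N, V (X n ω)) ^ 2) ∂μ := by
  have hae : ∀ N, (∑ n ∈ Finset.range N, Lp.compMeasurePreservingₗᵢ ℝ (X n) (hX n) (hV.toLp V) :
      Lp ℝ 2 μ) =ᵐ[μ] fun ω => ∑ n ∈ Finset.range N, V (X n ω) := by
    intro N
    induction N with
    | zero =>
      simp only [Finset.range_zero, Finset.sum_empty]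
      exact Lp.coeFn_zero ℝ 2 μ
    | succ N ih =>
      simp only [Finset.sum_range_succ]
      have h1 : (Lp.compMeasurePreservingₗᵢ ℝ (X N) (hX N) (hV.toLp V) : Lp ℝ 2 μ) =ᵐ[μ]
          fun ω => V (X N ω) := (hV.comp_measurePreserving (hX N)).coeFn_toLp
      filter_upwards [Lp.coeFn_add (∑ n ∈ Finset.range N,
        Lp.compMeasurePreservingₗᵢ ℝ (X n) (hX n) (hV.toLp V))
        (Lp.compMeasurePreservingₗᵢ ℝ (X N) (hX N) (hV.toLp V)), ih, h1] with ω e1 e2 e3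
      rw [e1, Pi.add_apply, e2, e3]
  set f : Lp ℝ 2 μ := ∑ n ∈ Finset.range N, Lp.compMeasurePreservingₗᵢ ℝ (X n) (hX n) (hV.toLp V)
  rw [← real_inner_self_eq_norm_sq, L2.inner_def,
    ofReal_integral_eq_lintegral_ofReal (L2.integrable_inner f f)
      (.of_forall fun ω => real_inner_self_nonneg)]
  refine lintegral_congr_ae ?_
  filter_upwards [hae N] with ω hω
  rw [real_inner_self_eq_norm_sq, Real.norm_eq_abs, sq_abs, hω]

end CountableLp

/-! ### The transition operator of the chain and its Dirichlet form. -/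

namespace IsMarkovChain

variable {Ω : Type*} [MeasurableSpace Ω] {μ : Measure Ω} [IsProbabilityMeasure μ]
  {p : ℕ → ℕ → ℝ} {X : ℕ → Ω → ℕ} (hX : IsMarkovChain μ p X) (hp : IsBirthDeathMatrix p)
  (hX0 : ∀ x, μ {ω | X 0 ω = x} = ENNReal.ofReal (invariantLaw p x))

include hX hp in
theorem measureReal_inter_succ {i n : ℕ} (hi : i ≤ n) (a y : ℕ) :
    μ.real (X i ⁻¹' {a} ∩ X (n + 1) ⁻¹' {y}) =
      ∑ b ∈ Finset.range (y + 2), p b y * μ.real (X i ⁻¹' {a} ∩ X n ⁻¹' {b}) := by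
  rw [measureReal_def, hX.measure_inter_succ hi, tsum_eq_sum (s := Finset.range (y + 2)),
    ENNReal.toReal_sum fun b _ => ENNReal.mul_ne_top (measure_ne_top _ _) ENNReal.ofReal_ne_top]
  · refine Finset.sum_congr rfl fun b _ => ?_
    rw [ENNReal.toReal_mul, ENNReal.toReal_ofReal (hp.nonneg _ _), mul_comm, measureReal_def]
  · intro b hb
    rw [Finset.mem_range] at hb
    rw [(hp.zero_iff b y).2 (by omega), ENNReal.ofReal_zero, mul_zero]

include hX hp hX0

theorem map_real_singleton (x : ℕ) : (μ.map (X 0)).real {x} = invariantLaw p x := by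
  rw [measureReal_def, Measure.map_apply (hX.measurable 0) (measurableSet_singleton x),
    hX.measure_eq_invariantLaw hp hX0, ENNReal.toReal_ofReal (hp.invariantLaw_nonneg x)]

theorem measureReal_zero_inter_one (x y : ℕ) :
    μ.real (X 0 ⁻¹' {x} ∩ X 1 ⁻¹' {y}) = invariantLaw p x * p x y := by
  have h := hX.measure_inter_inter (le_refl 0) x x y
  rw [Set.inter_self, hX.measure_eq_invariantLaw hp hX0] at h
  rw [measureReal_def, h, ENNReal.toReal_mul, ENNReal.toReal_ofReal (hp.invariantLaw_nonneg x),
    ENNReal.toReal_ofReal (hp.nonneg _ _)]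

theorem inner_transitionOperator_pointIndicator (x y : ℕ) :
    haveI := Measure.isProbabilityMeasure_map (hX.measurable 0).aemeasurable (μ := μ)
    inner ℝ (pointIndicator (μ.map (X 0)) x)
      (transitionOperator (hX.measurePreserving hp hX0 0) (hX.measurePreserving hp hX0 1)
        (pointIndicator (μ.map (X 0)) y)) = invariantLaw p x * p x y := by
  have := Measure.isProbabilityMeasure_map (hX.measurable 0).aemeasurable (μ := μ)
  rw [inner_transitionOperator, inner_comp_pointIndicator, hX.measureReal_zero_inter_one hp hX0]

theorem transitionOperator_pointIndicator (y : ℕ) :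
    haveI := Measure.isProbabilityMeasure_map (hX.measurable 0).aemeasurable (μ := μ)
    transitionOperator (hX.measurePreserving hp hX0 0) (hX.measurePreserving hp hX0 1)
      (pointIndicator (μ.map (X 0)) y) =
      ∑ b ∈ Finset.range (y + 2), p b y • pointIndicator (μ.map (X 0)) b := by
  have := Measure.isProbabilityMeasure_map (hX.measurable 0).aemeasurable (μ := μ)
  refine eq_of_forall_inner_pointIndicator fun x => ?_
  rw [hX.inner_transitionOperator_pointIndicator hp hX0, inner_sum]
  simp_rw [inner_smul_right, inner_pointIndicator_pointIndicator, mul_ite, mul_zero,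
    Finset.sum_ite_eq, hX.map_real_singleton hp hX0]
  split_ifs with h
  · rw [mul_comm]
  · rw [Finset.mem_range] at h
    rw [(hp.zero_iff x y).2 (by omega), mul_zero]

theorem transitionOperator_succ {i n : ℕ} (hi : i ≤ n) :
    transitionOperator (hX.measurePreserving hp hX0 i) (hX.measurePreserving hp hX0 (n + 1)) =
      transitionOperator (hX.measurePreserving hp hX0 i) (hX.measurePreserving hp hX0 n) *
      transitionOperator (hX.measurePreserving hp hX0 0) (hX.measurePreserving hp hX0 1) := by
  have := Measure.isProbabilityMeasure_map (hX.measurable 0).aemeasurable (μ := μ)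
  refine continuousLinearMap_ext_pointIndicator fun x y => ?_
  rw [mul_apply_eq_comp, hX.transitionOperator_pointIndicator hp hX0, map_sum, inner_sum,
    inner_transitionOperator, inner_comp_pointIndicator, hX.measureReal_inter_succ hp hi]
  refine Finset.sum_congr rfl fun b _ => ?_
  rw [map_smul, inner_smul_right, inner_transitionOperator, inner_comp_pointIndicator]

/-- The Markov property: the `k`-step transition operators are the powers of the one-step one. -/
theorem transitionOperator_eq_pow (i k : ℕ) :
    transitionOperator (hX.measurePreserving hp hX0 i) (hX.measurePreserving hp hX0 (i + k)) =
      transitionOperator (hX.measurePreserving hp hX0 0) (hX.measurePreserving hp hX0 1) ^ k := by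
  induction k with
  | zero => exact transitionOperator_self _
  | succ k ih =>
    rw [pow_succ, ← ih]
    exact hX.transitionOperator_succ hp hX0 (Nat.le_add_right i k)

theorem inner_transitionOperator_symm (f g : Lp ℝ 2 (μ.map (X 0))) :
    inner ℝ (transitionOperator (hX.measurePreserving hp hX0 0)
      (hX.measurePreserving hp hX0 1) f) g =
      inner ℝ f (transitionOperator (hX.measurePreserving hp hX0 0)
        (hX.measurePreserving hp hX0 1) g) := by
  have := Measure.isProbabilityMeasure_map (hX.measurable 0).aemeasurable (μ := μ)
  refine transitionOperator_symm _ _ (fun x y => ?_) f g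
  rw [hX.measureReal_zero_inter_one hp hX0, hX.measureReal_zero_inter_one hp hX0,
    hp.detailed_balance]

/-- The indicators of initial segments diagonalize the Dirichlet form. -/
theorem inner_initialIndicator_sub (m n : ℕ) :
    haveI := Measure.isProbabilityMeasure_map (hX.measurable 0).aemeasurable (μ := μ)
    inner ℝ (initialIndicator (μ.map (X 0)) m) (initialIndicator (μ.map (X 0)) n -
      transitionOperator (hX.measurePreserving hp hX0 0) (hX.measurePreserving hp hX0 1)
        (initialIndicator (μ.map (X 0)) n)) =
      if m = n then invariantLaw p n * p n (n + 1) else 0 := by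
  have := Measure.isProbabilityMeasure_map (hX.measurable 0).aemeasurable (μ := μ)
  wlog hmn : m ≤ n generalizing m n
  · have := this n m (by omega)
    rw [inner_sub_right, real_inner_comm, ← hX.inner_transitionOperator_symm hp hX0,
      real_inner_comm (initialIndicator (μ.map (X 0)) n), ← inner_sub_right, this]
    simp [show n ≠ m by omega, show m ≠ n by omega]
  -- Inside `[0, n]`, the function `(1 - P) 1_{[0, n]}` is the probability of leaving the segment,
  -- so only `x = n` contributes, and it lies in `[0, m]` only if `m = n`.
  have h1 : ∀ x ∈ Finset.range (m + 1), inner ℝ (pointIndicator (μ.map (X 0)) x)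
      (initialIndicator (μ.map (X 0)) n -
        transitionOperator (hX.measurePreserving hp hX0 0) (hX.measurePreserving hp hX0 1)
          (initialIndicator (μ.map (X 0)) n)) =
      if x = n then invariantLaw p n * p n (n + 1) else 0 := by
    intro x hx
    have hx := Finset.mem_range.1 hx
    have hxn : x ≤ n := by omega
    rw [initialIndicator, map_sum, inner_sub_right, inner_sum, inner_sum]
    simp_rw [hX.inner_transitionOperator_pointIndicator hp hX0,
      inner_pointIndicator_pointIndicator, hX.map_real_singleton hp hX0]
    rw [Finset.sum_ite_eq, if_pos (Finset.mem_range.2 (by omega)), ← Finset.mul_sum,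
      hp.sum_range_succ_of_le hxn]
    split_ifs with h
    · subst h
      ring
    · ring
  rw [initialIndicator, sum_inner, Finset.sum_congr rfl h1, Finset.sum_ite_eq']
  refine if_congr ?_ rfl rfl
  rw [Finset.mem_range]
  omega

/-- The asymptotic variance of an additive functional of a stationary birth and death chain. -/
theorem exists_tendsto_scaledSecondMoment {V : ℕ → ℝ}
    (hV : Summable fun x => V x ^ 2 * invariantLaw p x) :
    ∃ D : ℝ≥0∞, Tendsto (scaledSecondMoment μ X V) atTop (𝓝 D) ∧
      (D < ⊤ ↔ Summable fun x => (∑ y ∈ Finset.range (x + 1), V y * invariantLaw p y) ^ 2 /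
        (invariantLaw p x * p x (x + 1))) := by
  have := Measure.isProbabilityMeasure_map (hX.measurable 0).aemeasurable (μ := μ)
  have hm := hX.measurePreserving hp hX0
  have hVL : MemLp V 2 (μ.map (X 0)) :=
    memLp_two_of_summable (by simpa only [hX.map_real_singleton hp hX0] using hV)
  have hsymm := hX.inner_transitionOperator_symm hp hX0
  have hcontr := norm_transitionOperator_le (hm 0) (hm 1)
  obtain ⟨D, hD, hiff⟩ := exists_tendsto_norm_sum_sq_div hsymm hcontr (hVL.toLp V)
    (w := fun n => Lp.compMeasurePreservingₗᵢ ℝ (X n) (hm n) (hVL.toLp V)) fun i k => by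
      rw [← inner_transitionOperator, hX.transitionOperator_eq_pow hp hX0]
      rfl
  refine ⟨D, ?_, hiff.trans ((summable_pairedAutocov_iff hsymm hcontr _).trans ?_)⟩
  · simp_rw [ofReal_norm_sq_sum_comp hm hVL] at hD
    exact hD
  · rw [exists_inner_sq_le_iff (hVL.toLp V) (initialIndicator (μ.map (X 0)))
      (fun n => invariantLaw p n * p n (n + 1))
      (fun n => mul_pos (hX.invariantLaw_pos hp hX0 n) (hp.pos_right n))
      (hX.inner_initialIndicator_sub hp hX0) topologicalClosure_span_initialIndicator]
    simp_rw [inner_toLp_initialIndicator, hX.map_real_singleton hp hX0]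

end IsMarkovChain

/-! ### Removing the factor `p(x, x+1)`. -/

theorem tsum_ofReal_lt_top_iff {f : ℕ → ℝ} (hf : ∀ n, 0 ≤ f n) :
    ∑' n, ENNReal.ofReal (f n) < ⊤ ↔ Summable f := by
  refine ⟨fun h => ?_, fun h => h.tsum_ofReal_lt_top⟩
  simpa only [ENNReal.toReal_ofReal (hf _)] using ENNReal.summable_toReal h.ne

theorem theorem3 {Ω : Type*} [MeasurableSpace Ω] (μ : Measure Ω) [IsProbabilityMeasure μ]
    (p : ℕ → ℕ → ℝ) (c : ℕ → ℝ) (α : ℝ) (X : ℕ → Ω → ℕ) (V : ℕ → ℝ)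
    (hα : α ∈ Set.Ioo (0 : ℝ) 1)
    (hp : IsBirthDeathMatrix p)
    (hc : HasWeakLeftDrift p c α)
    (hX : IsMarkovChain μ p X)
    (hX0 : ∀ x, μ {ω | X 0 ω = x} = ENNReal.ofReal (invariantLaw p x))
    (hV : Summable fun x => V x ^ 2 * invariantLaw p x)
    (hV0 : HasSum (fun x => V x * invariantLaw p x) 0) :
    ∃ D : ℝ≥0∞, Tendsto (scaledSecondMoment μ X V) atTop (𝓝 D) ∧
      (D < ⊤ ↔
        ∑' x, ENNReal.ofReal
          (1 / invariantLaw p x * (∑ y ∈ Finset.range (x + 1), V y * invariantLaw p y) ^ 2) < ⊤) := by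
  obtain ⟨D, hD, hiff⟩ := hX.exists_tendsto_scaledSecondMoment hp hX0 hV
  obtain ⟨B, hB⟩ := hc.exists_forall_inv_le hα.1
  have hpos := hX.invariantLaw_pos hp hX0
  have hnn : ∀ x, 0 ≤ 1 / invariantLaw p x *
      (∑ y ∈ Finset.range (x + 1), V y * invariantLaw p y) ^ 2 := fun x =>
    mul_nonneg (one_div_nonneg.2 (hpos x).le) (sq_nonneg _)
  have heq : ∀ x, (∑ y ∈ Finset.range (x + 1), V y * invariantLaw p y) ^ 2 /
      (invariantLaw p x * p x (x + 1)) = (p x (x + 1))⁻¹ * (1 / invariantLaw p x *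
        (∑ y ∈ Finset.range (x + 1), V y * invariantLaw p y) ^ 2) := fun x => by
    have h1 := (hpos x).ne'
    have h2 := (hp.pos_right x).ne'
    field_simp
  refine ⟨D, hD, hiff.trans ?_⟩
  rw [tsum_ofReal_lt_top_iff hnn]
  simp_rw [heq]
  -- The two series are comparable since `1 ≤ (p x (x + 1))⁻¹ ≤ B`.
  constructor
  · refine fun h => h.of_nonneg_of_le hnn fun x => le_mul_of_one_le_left (hnn x) ?_
    exact (one_le_inv₀ (hp.pos_right x)).2 (hp.le_one _ _)
  · refine fun h => (h.mul_left B).of_nonneg_of_le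
      (fun x => mul_nonneg (inv_nonneg.2 (hp.nonneg _ _)) (hnn x)) fun x => ?_
    exact mul_le_mul_of_nonneg_right (hB x) (hnn x)
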